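/- Fix a path-loss exponent $\alpha>0$ and an SINR threshold $\beta>1$. Let $L=\{\ell_1,\dots,\ell_n\}$ be $n\ge 1$ links in the Euclidean plane, $\ell_i$ having sender $s_i$ and receiver $r_i$; put $d_{i,j}=d(s_i,r_j)$, assume the normalization $\min_{i,j}d_{i,j}=1$, and let $\Delta=\Delta(L)=\max_i d_{i,i}$. Let $N\ge 0$ be the background noise. Every sender either is silent or transmits at the uniform power $P>0$; if $s_i$ transmits, its signal has strength $P_{i,j}=P/d_{i,j}^{\alpha}$ at $r_j$, otherwise $P_{i,j}=0$. With interference cancellation (IC), $r_j$ can decode a transmitting $s_i$ iff $P_{i,j}\ge\beta\bigl(\sum_{k\ne i,\,P_{k,j}\le P_{i,j}}P_{k,j}+N\bigr)$ and $r_j$ can decode every $s_k$ with $P_{k,j}>P_{i,j}$; link $\ell_j$ is successful iff $s_j$ transmits and $r_j$ can decode $s_j$. Let $OPT^{IC}$ be a largest subset of $L$ all of whose links are successful when exactly its senders transmit. In the game, each link chooses whether to transmit and has utility $1$ if it transmits successfully, $-1$ if it transmits unsuccessfully, $0$ if it is silent. A history is a sequence of $T\ge1$ strategy profiles; it is an $\epsilon$-regret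 history if, for every player, the average utility in the history is at least the average utility of any fixed strategy played in all rounds (against the same moves of the others) minus $\epsilon$. Let $\mathcal N^{IC}_{\min}(L)$ be the infimum, over all $\epsilon$-regret histories, of the average number of successful links per round, and let the price of total anarchy be $|OPT^{IC}|/\mathcal N^{IC}_{\min}(L)\in[0,\infty]$ (read as $0$ if $|OPT^{IC}|=0$). (Upper bound.) For every $\kappa<\tfrac12$ there is a constant $C=C(\alpha,\beta,\kappa)>0$ such that for all $N\ge0$, $P>0$, $n$, every such $L$, and all $0\le\epsilon\le\kappa/n$, $$\frac{|OPT^{IC}|}{\mathcal N^{IC}_{\min}(L)}\le C\,(1+\log\Delta).$$ (Tightness.) There are constants $c>0$ and $\Delta_0>1$, depending only on $\alpha,\beta$, such that for every $N\ge0$ and every $\Delta\ge\Delta_0$, for all sufficiently large powers $P$, there is such a link set $L$ with $\Delta(L)=\Delta$ and a pure Nash equilibrium of the game with IC in which the number $v$ of successful links satisfies $v>0$ and $|OPT^{IC}|\ge c\,\log\Delta\cdot v$; moreover $|OPT^{IC}|/\mathcal N^{IC}_{\min}(L)\ge c\log\Delta$ for every $\epsilon\ge0$. -/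

import Mathlib

open scoped ENNReal

namespace SINR

/-- The Euclidean plane. -/
abbrev Plane := EuclideanSpace ℝ (Fin 2)

/-- A set of `n` links in the plane; link `i` goes from `sender i` to `receiver i`. -/
structure LinkSet (n : ℕ) where
  sender : Fin n → Plane
  receiver : Fin n → Plane

/-- A strategy profile of the game without power control:
`true` = transmit at full power, `false` = stay silent. -/
abbrev Profile (n : ℕ) := Fin n → Bool

namespace LinkSet

variable {n : ℕ}

/-- The distance from the sender of link `i` to the receiver of link `j`. -/
noncomputable def d (L : LinkSet n) (i j : Fin n) : ℝ := dist (L.sender i) (L.receiver j)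

/-- The minimum sender-receiver distance is `1`. -/
def Normalized (L : LinkSet n) : Prop := (∀ i j, 1 ≤ L.d i j) ∧ ∃ i j, L.d i j = 1

/-- The length of the longest link. -/
noncomputable def delta (L : LinkSet n) : ℝ := ⨆ i, L.d i i

/-- Strength at receiver `j` of the signal of sender `i` under the power assignment `p`. -/
noncomputable def received (L : LinkSet n) (α : ℝ) (p : Fin n → ℝ) (i j : Fin n) : ℝ :=
  p i / (L.d i j) ^ α

open Classical in
/-- Interference met by the signal of sender `i` at receiver `j` once all stronger signals
have been cancelled: the total strength of the other signals that are not stronger. -/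
noncomputable def residual (L : LinkSet n) (α : ℝ) (p : Fin n → ℝ) (i j : Fin n) : ℝ :=
  ∑ k with k ≠ i ∧ L.received α p k j ≤ L.received α p i j, L.received α p k j

/-- Receiver `j`, using interference cancellation, can decode the sender `i`: sender `i`
transmits, `j` can decode every stronger signal, and the ratio of the signal of `i` to the
residual interference plus noise is at least `β` (written without a division, so that
zero interference plus noise means an infinite ratio). -/
inductive CanDecode (L : LinkSet n) (α β N : ℝ) (p : Fin n → ℝ) (j : Fin n) : Fin n → Prop
  | intro (i : Fin n)
      (transmits : 0 < p i)
      (ratio : β * (L.residual α p i j + N) ≤ L.received α p i j)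
      (stronger : ∀ k, L.received α p i j < L.received α p k j → CanDecode L α β N p j k) :
      CanDecode L α β N p j i

/-- Uniform powers: a sender that transmits uses power `P`. -/
def power (P : ℝ) (a : Profile n) (i : Fin n) : ℝ := if a i then P else 0

/-- Link `i` is successful with interference cancellation. -/
def Success (L : LinkSet n) (α β N P : ℝ) (a : Profile n) (i : Fin n) : Prop :=
  L.CanDecode α β N (power P a) i i

open Classical in
/-- The number of successful links. -/
noncomputable def numSuccess (L : LinkSet n) (α β N P : ℝ) (a : Profile n) : ℕ :=
  (Finset.univ.filter fun i => L.Success α β N P a i).card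

open Classical in
/-- `1` for a successful link, `-1` for a failed transmission, `0` for silence. -/
noncomputable def utility (L : LinkSet n) (α β N P : ℝ) (a : Profile n) (i : Fin n) : ℝ :=
  if a i then (if L.Success α β N P a i then 1 else -1) else 0

/-- Pure Nash equilibrium. -/
def IsPureNash (L : LinkSet n) (α β N P : ℝ) (a : Profile n) : Prop :=
  ∀ (i : Fin n) (s : Bool),
    L.utility α β N P (Function.update a i s) i ≤ L.utility α β N P a i

/-- Regret of player `i` in the history `H` of `T` rounds. -/
noncomputable def regret (L : LinkSet n) (α β N P : ℝ) {T : ℕ} (H : Fin T → Profile n)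
    (i : Fin n) : ℝ :=
  (⨆ s : Bool, (1 / (T : ℝ)) * ∑ t, L.utility α β N P (Function.update (H t) i s) i)
    - (1 / (T : ℝ)) * ∑ t, L.utility α β N P (H t) i

/-- Every player has regret at most `ε`. -/
def IsRegretHistory (L : LinkSet n) (α β N P ε : ℝ) {T : ℕ} (H : Fin T → Profile n) : Prop :=
  ∀ i, L.regret α β N P H i ≤ ε

/-- Number of successful links, averaged over the rounds. -/
noncomputable def avgSuccess (L : LinkSet n) (α β N P : ℝ) {T : ℕ} (H : Fin T → Profile n) : ℝ :=
  (1 / (T : ℝ)) * ∑ t, (L.numSuccess α β N P (H t) : ℝ)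

/-- The worst average number of successful links over all `ε`-regret histories of any
positive length. -/
noncomputable def nMin (L : LinkSet n) (α β N P ε : ℝ) : ℝ≥0∞ :=
  ⨅ (T : ℕ) (_ : 0 < T) (H : Fin T → Profile n) (_ : L.IsRegretHistory α β N P ε H),
    ENNReal.ofReal (L.avgSuccess α β N P H)

/-- All links of `S` succeed when exactly the senders of `S` transmit. -/
def Feasible (L : LinkSet n) (α β N P : ℝ) (S : Finset (Fin n)) : Prop :=
  ∀ i ∈ S, L.Success α β N P (fun k => decide (k ∈ S)) i

open Classical in
/-- The largest size of a set of links that is feasible with interference cancellation. -/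
noncomputable def opt (L : LinkSet n) (α β N P : ℝ) : ℕ :=
  (Finset.univ.filter fun S : Finset (Fin n) => L.Feasible α β N P S).sup Finset.card

/-- Price of total anarchy with interference cancellation, in `[0, ∞]`; it is `∞` if some
link can succeed but the worst value is `0`, and `0` if no link can ever succeed. -/
noncomputable def priceOfTotalAnarchy (L : LinkSet n) (α β N P ε : ℝ) : ℝ≥0∞ :=
  (L.opt α β N P : ℝ≥0∞) / L.nMin α β N P ε

end LinkSet

end SINR

/-!
The upper bound combines three facts.

*Cancellation gains at most a logarithmic factor.* In a set that is feasible with cancellation,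
each receiver has to cancel a chain of signals whose strengths grow by the factor `β` from one to
the next. The weakest is the link's own, at least `P / Δ ^ α`, and the strongest is at most `P`, so
that the chain has length `O(log Δ)` (`Feasible.card_stronger_le`). The digraph "link `i` cancels
sender `k`" has therefore small out-degree, and a large independent set of it is feasible without
any cancellation (`Feasible.exists_plainFeasible`).

*A plainly feasible set is hard to block.* Half of its links have total affectance at most `2` on
the set. Compare an arbitrary sender `v` with the link `u` of this half whose receiver is nearest
to `v`: since `1 < β` separates the links, the distance from `s_u` to any other receiver of the half
is at most a constant times the distance from `s_v`. Hence `v` blocks only boundedly many links of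
this half (`PlainFeasible.exists_amicable`); this needs only the triangle inequality, and holds for
every `α > 0`.

*Small regret.* Comparing with silence shows that the average number of transmissions is at most
twice the average number of successes, plus `n * ε`. Comparing with permanent transmission shows
that a link which transmits rarely would fail in a constant fraction of the rounds, so that by the
previous fact the half above is at most a constant times the average number of transmissions
(`IsRegretHistory.card_amicable_le`). The term `n * ε` is absorbed because the average number of
successes is at least `(1 / 2 - n * ε) / 2` as soon as one link can overcome the noise
(`IsRegretHistory.le_avgSuccess`).

For the lower bound, let `m` links share their receiver, with senders at distances forming a
geometric progression between a constant `R` and `Δ`. With cancellation all `m = Θ(log Δ)` of them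
succeed together. Two short links with senders at distance `R` from the common receiver, on
opposite sides, succeed together as well, but their signals tie at the common receiver, so neither
can be cancelled there and every link of the progression is blocked. The two short links
transmitting alone form a pure Nash equilibrium (`jammedTower_isPureNash`).
-/

namespace SINR

/-! ### Independent sets in digraphs of bounded out-degree -/

open Classical in
/-- A digraph of out-degree at most `D` has an independent set containing a `1 / (2 * D + 1)`
fraction of its vertices: some vertex has total degree at most `2 * D`; keep it, discard its
neighbours and repeat. -/
lemma exists_independent_of_outdegree_le {V : Type*} (R : V → V → Prop) (D : ℝ)
    (O : Finset V) (hO : ∀ i ∈ O, ((O.filter (R i)).card : ℝ) ≤ D) :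
    ∃ I ⊆ O, (O.card : ℝ) ≤ (2 * D + 1) * I.card ∧
      ∀ i ∈ I, ∀ j ∈ I, i ≠ j → ¬ R i j := by
  induction O using Finset.strongInduction with
  | H O ih =>
  rcases O.eq_empty_or_nonempty with rfl | hne
  · exact ⟨∅, by simp⟩
  obtain ⟨i, hi, hdeg⟩ : ∃ i ∈ O,
      ((O.filter (R i)).card : ℝ) + ((O.filter fun j => R j i).card : ℝ) ≤ 2 * D := by
    apply Finset.exists_le_of_sum_le hne
    have hswap : ∑ i ∈ O, ((O.filter fun j => R j i).card : ℝ)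
        = ∑ i ∈ O, ((O.filter (R i)).card : ℝ) := by
      simp only [Finset.card_filter, Nat.cast_sum]
      exact Finset.sum_comm
    rw [Finset.sum_add_distrib, hswap]
    have := Finset.sum_le_sum hO
    simp only [Finset.sum_const, nsmul_eq_mul] at this ⊢
    linarith
  set B : Finset V := insert i (O.filter (R i) ∪ O.filter fun j => R j i) with hB
  have hsub : O \ B ⊂ O := by
    refine Finset.ssubset_iff_subset_ne.2 ⟨Finset.sdiff_subset, fun h => ?_⟩
    have : i ∈ O \ B := by rw [h]; exact hi
    simp [hB] at this
  obtain ⟨I, hsubI, hcard, hind⟩ := ih (O \ B) hsub fun j hj => by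
    refine le_trans ?_ (hO j (Finset.mem_sdiff.1 hj).1)
    exact_mod_cast Finset.card_le_card (Finset.filter_subset_filter _ Finset.sdiff_subset)
  have hmem : ∀ j ∈ I, j ≠ i ∧ ¬ R i j ∧ ¬ R j i := fun j hj => by
    have := hsubI hj
    simp only [hB, Finset.mem_sdiff, Finset.mem_insert, Finset.mem_union, Finset.mem_filter] at this
    tauto
  refine ⟨insert i I, ?_, ?_, ?_⟩
  · exact Finset.insert_subset hi (hsubI.trans Finset.sdiff_subset)
  · have hiI : i ∉ I := fun h => (hmem i h).1 rfl
    rw [Finset.card_insert_of_notMem hiI]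
    have h1 : O.card ≤ (O \ B).card + B.card := by
      have := Finset.le_card_sdiff B O
      omega
    have h2 : B.card ≤ (O.filter (R i)).card + (O.filter fun j => R j i).card + 1 :=
      (Finset.card_insert_le _ _).trans (Nat.succ_le_succ (Finset.card_union_le _ _))
    have h1' : (O.card : ℝ) ≤ (O \ B).card + B.card := by exact_mod_cast h1
    have h2' : (B.card : ℝ) ≤ (O.filter (R i)).card + (O.filter fun j => R j i).card + 1 := by
      exact_mod_cast h2
    push_cast
    linarith
  · intro j hj k hk hjk
    rcases Finset.mem_insert.1 hj with rfl | hj' <;> rcases Finset.mem_insert.1 hk with rfl | hk'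
    · exact absurd rfl hjk
    · exact (hmem k hk').2.1
    · exact (hmem j hj').2.2
    · exact hind j hj' k hk' hjk

namespace LinkSet

variable {n : ℕ}

/-! ### Signals and decoding -/

/-- Strength at receiver `j` of the signal of sender `i` when `i` transmits with power `P`. -/
noncomputable def signal (L : LinkSet n) (α P : ℝ) (i j : Fin n) : ℝ := P / (L.d i j) ^ α

lemma received_power (L : LinkSet n) (α P : ℝ) (a : Profile n) (i j : Fin n) :
    L.received α (power P a) i j = if a i then L.signal α P i j else 0 := by
  unfold received power signal
  split_ifs <;> simp

lemma Normalized.one_le_d {L : LinkSet n} (hL : L.Normalized) (i j : Fin n) : 1 ≤ L.d i j :=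
  hL.1 i j

lemma Normalized.signal_pos {L : LinkSet n} (hL : L.Normalized) {α P : ℝ} (hP : 0 < P)
    (i j : Fin n) : 0 < L.signal α P i j :=
  div_pos hP (Real.rpow_pos_of_pos (by linarith [hL.one_le_d i j]) _)

lemma Success.transmits {L : LinkSet n} {α β N P : ℝ} {a : Profile n} {i : Fin n}
    (h : L.Success α β N P a i) : a i = true := by
  cases h with
  | intro _ ht _ _ =>
    by_contra hi
    simp [power, hi] at ht

open Classical in
/-- A link that clears the threshold against the interference of all other senders is
successful: as `1 < β`, no signal is stronger than its own, so there is nothing to cancel. -/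
lemma success_of_sinr {L : LinkSet n} (hL : L.Normalized) {α β N P : ℝ} (hβ : 1 < β)
    (hN : 0 ≤ N) (hP : 0 < P) {a : Profile n} {i : Fin n} (hi : a i = true)
    (h : β * ((∑ k with k ≠ i ∧ a k = true, L.signal α P k i) + N) ≤ L.signal α P i i) :
    L.Success α β N P a i := by
  have hnn : ∀ k, 0 ≤ L.signal α P k i := fun k => (hL.signal_pos hP k i).le
  have hrec : ∀ k, 0 ≤ L.received α (power P a) k i := fun k => by
    rw [received_power]; split_ifs
    · exact hnn k
    · exact le_rfl
  have hall : ∑ k with k ≠ i ∧ a k = true, L.signal α P k i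
      = ∑ k with k ≠ i, L.received α (power P a) k i := by
    simp only [received_power, Finset.sum_filter, ite_and]
  have hS : 0 ≤ ∑ k with k ≠ i, L.received α (power P a) k i :=
    Finset.sum_nonneg fun k _ => hrec k
  rw [hall] at h
  have hii : L.received α (power P a) i i = L.signal α P i i := by simp [received_power, hi]
  refine CanDecode.intro i (by simpa [power, hi] using hP) ?_ fun k hk => ?_
  · rw [hii]
    refine le_trans ?_ h
    have : L.residual α (power P a) i i ≤ ∑ k with k ≠ i, L.received α (power P a) k i := by
      apply Finset.sum_le_sum_of_subset_of_nonneg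
      · intro k hk
        simp only [Finset.mem_filter] at hk ⊢
        exact ⟨hk.1, hk.2.1⟩
      · exact fun k _ _ => hrec k
    gcongr
  · exfalso
    have hki : k ≠ i := by rintro rfl; exact lt_irrefl _ hk
    have hle : L.received α (power P a) k i ≤ ∑ k with k ≠ i, L.received α (power P a) k i :=
      Finset.single_le_sum (f := fun k => L.received α (power P a) k i)
        (fun k _ => hrec k) (by simp [hki])
    rw [hii] at hk
    nlinarith

open Classical in
/-- Each signal that is decoded on the way to the target is at least `β` times as strong as the
next one, so a decodable signal of strength `x` has at most `log (P / x) / log β` signals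
above it. -/
lemma CanDecode.pow_card_stronger_le {L : LinkSet n} (hL : L.Normalized) {α β N P : ℝ}
    (hα : 0 < α) (hβ : 1 < β) (hN : 0 ≤ N) (hP : 0 < P) {a : Profile n} {i j : Fin n}
    (h : L.CanDecode α β N (power P a) j i) :
    β ^ (Finset.univ.filter fun k =>
      L.received α (power P a) i j < L.received α (power P a) k j).card
        * L.received α (power P a) i j ≤ P := by
  have hrec : ∀ k, 0 ≤ L.received α (power P a) k j := fun k => by
    rw [received_power]; split_ifs
    · exact (hL.signal_pos hP k j).le
    · exact le_rfl
  induction h with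
  | intro i ht hr hs ih =>
  set W := Finset.univ.filter fun k =>
      L.received α (power P a) i j < L.received α (power P a) k j with hW
  rcases W.eq_empty_or_nonempty with he | hne
  · rw [he, Finset.card_empty, pow_zero, one_mul, received_power]
    split_ifs
    · exact div_le_self hP.le (Real.one_le_rpow (hL.one_le_d i j) hα.le)
    · exact hP.le
  -- the weakest of the signals stronger than `i`
  obtain ⟨k, hkW, hkmin⟩ := W.exists_min_image (fun k => L.received α (power P a) k j) hne
  have hk : L.received α (power P a) i j < L.received α (power P a) k j :=
    (Finset.mem_filter.1 hkW).2
  have hres : ∀ l, l ≠ k → L.received α (power P a) l j ≤ L.received α (power P a) k j →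
      β * L.received α (power P a) l j ≤ L.received α (power P a) k j := fun l hl hle => by
    cases hs k hk with
    | intro _ _ hr' _ =>
      refine le_trans ?_ hr'
      have : L.received α (power P a) l j ≤ L.residual α (power P a) k j :=
        Finset.single_le_sum (f := fun k => L.received α (power P a) k j)
          (fun k _ => hrec k) (by simp [hl, hle])
      have hβ0 : 0 ≤ β := by linarith
      gcongr
      linarith
  have hkpos : 0 < L.received α (power P a) k j := (hrec i).trans_lt hk
  have hsub : W ⊆ insert k (Finset.univ.filter fun l =>
      L.received α (power P a) k j < L.received α (power P a) l j) := by
    intro l hl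
    by_cases hlk : l = k
    · simp [hlk]
    refine Finset.mem_insert_of_mem (Finset.mem_filter.2 ⟨Finset.mem_univ _, ?_⟩)
    by_contra hcon
    have h1 := hres l hlk (not_lt.1 hcon)
    have h2 := hkmin l hl
    nlinarith
  have hcard := (Finset.card_le_card hsub).trans (Finset.card_insert_le _ _)
  have hik : β * L.received α (power P a) i j ≤ L.received α (power P a) k j :=
    hres i (by rintro rfl; exact lt_irrefl _ hk) hk.le
  calc β ^ W.card * L.received α (power P a) i j
      ≤ β ^ ((Finset.univ.filter fun l =>
          L.received α (power P a) k j < L.received α (power P a) l j).card + 1)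
          * L.received α (power P a) i j := by
        gcongr
        · exact hrec i
        · exact hβ.le
    _ = β ^ (Finset.univ.filter fun l =>
          L.received α (power P a) k j < L.received α (power P a) l j).card
          * (β * L.received α (power P a) i j) := by ring
    _ ≤ β ^ (Finset.univ.filter fun l =>
          L.received α (power P a) k j < L.received α (power P a) l j).card
          * L.received α (power P a) k j := by
        gcongr
    _ ≤ P := ih k hk

lemma d_le_delta (L : LinkSet n) (i : Fin n) : L.d i i ≤ L.delta :=
  le_ciSup (f := fun i => L.d i i) (Set.finite_range _).bddAbove i

lemma Normalized.one_le_delta {L : LinkSet n} (hL : L.Normalized) : 1 ≤ L.delta := by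
  obtain ⟨i, -, -⟩ := hL.2
  exact (hL.one_le_d i i).trans (L.d_le_delta i)

/-! ### Feasibility without cancellation -/

open Classical in
/-- All links of `S` clear the threshold against the total interference of `S`, without any
cancellation. -/
def PlainFeasible (L : LinkSet n) (α β N P : ℝ) (S : Finset (Fin n)) : Prop :=
  ∀ i ∈ S, β * ((∑ k ∈ S.erase i, L.signal α P k i) + N) ≤ L.signal α P i i

open Classical in
lemma Feasible.card_stronger_le {L : LinkSet n} (hL : L.Normalized) {α β N P : ℝ}
    (hα : 0 < α) (hβ : 1 < β) (hN : 0 ≤ N) (hP : 0 < P) {S : Finset (Fin n)}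
    (hS : L.Feasible α β N P S) {i : Fin n} (hi : i ∈ S) :
    ((S.filter fun k => L.signal α P i i < L.signal α P k i).card : ℝ)
      ≤ α * Real.log L.delta / Real.log β := by
  have h := (hS i hi).pow_card_stronger_le hL hα hβ hN hP
  have hset : (Finset.univ.filter fun k =>
      L.received α (power P fun k => decide (k ∈ S)) i i
        < L.received α (power P fun k => decide (k ∈ S)) k i)
      = S.filter fun k => L.signal α P i i < L.signal α P k i := by
    ext k
    by_cases hk : k ∈ S
    · simp [received_power, hi, hk]
    · simpa [received_power, hi, hk] using (hL.signal_pos hP i i).le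
  rw [hset] at h
  set x := (S.filter fun k => L.signal α P i i < L.signal α P k i).card
  have hd : 0 < L.d i i := by linarith [hL.one_le_d i i]
  have hrec : L.received α (power P fun k => decide (k ∈ S)) i i = P / L.d i i ^ α := by
    simp [received_power, hi, signal]
  rw [hrec, ← mul_div_assoc, div_le_iff₀ (Real.rpow_pos_of_pos hd _), mul_comm] at h
  have h1 : β ^ x ≤ L.d i i ^ α := le_of_mul_le_mul_left h hP
  have h2 : β ^ x ≤ L.delta ^ α :=
    h1.trans (Real.rpow_le_rpow hd.le (L.d_le_delta i) hα.le)
  have h3 := Real.log_le_log (by positivity) h2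
  rw [Real.log_pow, Real.log_rpow (by linarith [hL.one_le_delta])] at h3
  rwa [le_div_iff₀ (Real.log_pos hβ)]

open Classical in
/-- Cancellation gains at most a logarithmic factor: join `i` to the links whose signals `i` has
to cancel; an independent set of this digraph needs no cancellation. -/
lemma Feasible.exists_plainFeasible {L : LinkSet n} (hL : L.Normalized) {α β N P : ℝ}
    (hα : 0 < α) (hβ : 1 < β) (hN : 0 ≤ N) (hP : 0 < P) {S : Finset (Fin n)}
    (hS : L.Feasible α β N P S) :
    ∃ I ⊆ S, (S.card : ℝ) ≤ (2 * (α * Real.log L.delta / Real.log β) + 1) * I.card ∧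
      L.PlainFeasible α β N P I := by
  obtain ⟨I, hIS, hcard, hind⟩ := exists_independent_of_outdegree_le
    (fun i k => L.signal α P i i < L.signal α P k i) _ S
    fun i hi => hS.card_stronger_le hL hα hβ hN hP hi
  refine ⟨I, hIS, hcard, fun i hi => ?_⟩
  have hiS := hIS hi
  cases hS i hiS with
  | intro _ _ hr _ =>
    have hii : L.received α (power P fun k => decide (k ∈ S)) i i = L.signal α P i i := by
      simp [received_power, hiS]
    rw [hii] at hr
    refine le_trans ?_ hr
    have hβ0 : 0 ≤ β := by linarith
    gcongr
    have hrw : ∑ k ∈ I.erase i, L.signal α P k i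
        = ∑ k ∈ I.erase i, L.received α (power P fun k => decide (k ∈ S)) k i :=
      Finset.sum_congr rfl fun k hk => by
        simp [received_power, hIS (Finset.mem_of_mem_erase hk)]
    rw [hrw]
    apply Finset.sum_le_sum_of_subset_of_nonneg
    · intro k hk
      have hk' := Finset.mem_erase.1 hk
      have := not_lt.1 (hind i hi k hk'.2 hk'.1.symm)
      simp only [Finset.mem_filter, Finset.mem_univ, true_and]
      refine ⟨hk'.1, ?_⟩
      rw [hii]
      simpa [received_power, hIS hk'.2] using this
    · intro k _ _
      rw [received_power]
      split_ifs
      · exact (hL.signal_pos hP k i).le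
      · exact le_rfl

/-! ### Affectance -/

/-- The affectance of sender `k` on link `i`: the strength of `k` at receiver `i` relative to the
interference that link `i` tolerates on top of the noise. -/
noncomputable def affectance (L : LinkSet n) (α β N P : ℝ) (k i : Fin n) : ℝ :=
  β * L.signal α P k i / (L.signal α P i i - β * N)

/-- In a plainly feasible set, `s_u` is farther from `r_w` than `s_w` is, by at least the factor
`β ^ (1 / α)`. -/
lemma PlainFeasible.mul_d_le {L : LinkSet n} (hL : L.Normalized) {α β N P : ℝ}
    (hα : 0 < α) (hβ : 1 < β) (hN : 0 ≤ N) (hP : 0 < P) {S : Finset (Fin n)}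
    (hS : L.PlainFeasible α β N P S) {u w : Fin n} (hu : u ∈ S) (hw : w ∈ S) (huw : u ≠ w) :
    β ^ (1 / α) * L.d w w ≤ L.d u w := by
  classical
  have h := hS w hw
  have hle : L.signal α P u w ≤ ∑ k ∈ S.erase w, L.signal α P k w :=
    Finset.single_le_sum (f := fun k => L.signal α P k w)
      (fun k _ => (hL.signal_pos hP k w).le) (Finset.mem_erase.2 ⟨huw, hu⟩)
  have hβ0 : 0 ≤ β := by linarith
  have h1 : β * L.signal α P u w ≤ L.signal α P w w := by nlinarith
  have hdw : 0 < L.d w w := by linarith [hL.one_le_d w w]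
  have hdu : 0 < L.d u w := by linarith [hL.one_le_d u w]
  have pw := Real.rpow_pos_of_pos hdw α
  have pu := Real.rpow_pos_of_pos hdu α
  unfold signal at h1
  rw [← mul_div_assoc, div_le_div_iff₀ pu pw] at h1
  have h2 : β * L.d w w ^ α ≤ L.d u w ^ α := by
    refine le_of_mul_le_mul_left ?_ hP
    linarith
  refine (Real.rpow_le_rpow_iff (by positivity) hdu.le hα).1 ?_
  rwa [Real.mul_rpow (by positivity) hdw.le, ← Real.rpow_mul hβ0, one_div,
    inv_mul_cancel₀ hα.ne', Real.rpow_one]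

/-- The factor by which affectance can change when a sender is replaced by the sender of the
link with the nearest receiver. -/
noncomputable def transferConst (α β : ℝ) : ℝ :=
  (2 * β ^ (1 / α) / (β ^ (1 / α) - 1)) ^ α

lemma one_lt_root {α β : ℝ} (hα : 0 < α) (hβ : 1 < β) : 1 < β ^ (1 / α) :=
  Real.one_lt_rpow hβ (by positivity)

lemma transferConst_nonneg {α β : ℝ} (hα : 0 < α) (hβ : 1 < β) : 0 ≤ transferConst α β := by
  have := one_lt_root hα hβ
  exact Real.rpow_nonneg (div_nonneg (by linarith) (by linarith)) _

lemma signal_le_transferConst_mul {L : LinkSet n} (hL : L.Normalized) {α β N P : ℝ}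
    (hα : 0 < α) (hβ : 1 < β) (hN : 0 ≤ N) (hP : 0 < P) {S : Finset (Fin n)}
    (hS : L.PlainFeasible α β N P S) {u w v : Fin n} (hu : u ∈ S) (hw : w ∈ S) (huw : u ≠ w)
    (hnear : L.d v u ≤ L.d v w) :
    L.signal α P v w ≤ transferConst α β * L.signal α P u w := by
  have hq := one_lt_root hα hβ
  have h1 := hS.mul_d_le hL hα hβ hN hP hu hw huw
  have h2 := hS.mul_d_le hL hα hβ hN hP hw hu huw.symm
  have t1 : L.d u w ≤ L.d u u + L.d v u + L.d v w := by
    unfold d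
    have := dist_triangle4 (L.sender u) (L.receiver u) (L.sender v) (L.receiver w)
    rwa [dist_comm (L.receiver u) (L.sender v)] at this
  have t2 : L.d w u ≤ L.d w w + L.d v w + L.d v u := by
    unfold d
    have := dist_triangle4 (L.sender w) (L.receiver w) (L.sender v) (L.receiver u)
    rwa [dist_comm (L.receiver w) (L.sender v)] at this
  unfold transferConst signal
  set q := β ^ (1 / α) with hqdef
  have hvw : 0 < L.d v w := by linarith [hL.one_le_d v w]
  have huw' : 0 < L.d u w := by linarith [hL.one_le_d u w]
  -- the two separation inequalities bound the length of `u` by the distance from `s_v` to `r_w`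
  have h3 : (q - 1) * L.d u u ≤ 2 * L.d v w := by
    have h4 : q * (q * L.d u u) ≤ q * (L.d w w + 2 * L.d v w) := by
      apply mul_le_mul_of_nonneg_left _ (by linarith)
      linarith
    have h5 : (q + 1) * ((q - 1) * L.d u u) ≤ (q + 1) * (2 * L.d v w) := by nlinarith
    exact le_of_mul_le_mul_left h5 (by linarith)
  have h6 : L.d u w ≤ 2 * q / (q - 1) * L.d v w := by
    rw [div_mul_eq_mul_div, le_div_iff₀ (by linarith)]
    nlinarith
  have h7 : L.d u w ^ α ≤ (2 * q / (q - 1)) ^ α * L.d v w ^ α := by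
    rw [← Real.mul_rpow (div_nonneg (by linarith) (by linarith)) hvw.le]
    exact Real.rpow_le_rpow huw'.le h6 hα.le
  have pv := Real.rpow_pos_of_pos hvw α
  have pu := Real.rpow_pos_of_pos huw' α
  rw [← mul_div_assoc, div_le_div_iff₀ pv pu]
  nlinarith

open Classical in
/-- Half of a plainly feasible set consists of links whose total affectance on the set is at
most `2`. Any sender at all then has bounded truncated affectance on this half: away from the link
`u` with the nearest receiver it affects the others at most a constant times as much as `u` does. -/
lemma PlainFeasible.exists_amicable {L : LinkSet n} (hL : L.Normalized) {α β N P : ℝ}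
    (hα : 0 < α) (hβ : 1 < β) (hN : 0 ≤ N) (hP : 0 < P) {S : Finset (Fin n)}
    (hS : L.PlainFeasible α β N P S) (hslack : ∀ i ∈ S, 0 < L.signal α P i i - β * N) :
    ∃ I ⊆ S, S.card ≤ 2 * I.card ∧ ∀ v,
      ∑ w ∈ I, min 1 (L.affectance α β N P v w) ≤ 1 + 2 * transferConst α β := by
  have hβ0 : 0 < β := by linarith
  have haff : ∀ k, ∀ i ∈ S, 0 ≤ L.affectance α β N P k i := fun k i hi =>
    div_nonneg (mul_nonneg hβ0.le (hL.signal_pos hP k i).le) (hslack i hi).le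
  have hin : ∀ i ∈ S, ∑ k ∈ S.erase i, L.affectance α β N P k i ≤ 1 := fun i hi => by
    unfold affectance
    rw [← Finset.sum_div, ← Finset.mul_sum, div_le_one (hslack i hi)]
    linarith [hS i hi]
  set out : Fin n → ℝ := fun u => ∑ w ∈ S.erase u, L.affectance α β N P u w with hout
  have hout0 : ∀ u, 0 ≤ out u := fun u =>
    Finset.sum_nonneg fun w hw => haff u w (Finset.mem_of_mem_erase hw)
  have htotal : ∑ u ∈ S, out u ≤ S.card := by
    have hswap : ∑ u ∈ S, out u = ∑ i ∈ S, ∑ k ∈ S.erase i, L.affectance α β N P k i := by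
      apply Finset.sum_comm'
      intro x y
      simp only [Finset.mem_erase]
      tauto
    rw [hswap]
    simpa using Finset.sum_le_sum hin
  refine ⟨S.filter fun u => out u ≤ 2, Finset.filter_subset _ _, ?_, fun v => ?_⟩
  · have hsplit := Finset.card_filter_add_card_filter_not (s := S) (fun u => out u ≤ 2)
    have hbig : (2 : ℝ) * (S.filter fun u => ¬ out u ≤ 2).card ≤ S.card := by
      refine le_trans ?_ htotal
      refine le_trans ?_ (Finset.sum_le_sum_of_subset_of_nonneg
        (Finset.filter_subset (fun u => ¬ out u ≤ 2) S) fun u _ _ => hout0 u)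
      rw [mul_comm, ← nsmul_eq_mul]
      exact Finset.card_nsmul_le_sum _ _ _ fun u hu => (not_le.1 (Finset.mem_filter.1 hu).2).le
    have hbig' : 2 * (S.filter fun u => ¬ out u ≤ 2).card ≤ S.card := by exact_mod_cast hbig
    omega
  · set I := S.filter fun u => out u ≤ 2 with hI
    have hK := transferConst_nonneg hα hβ
    rcases I.eq_empty_or_nonempty with he | hne
    · rw [he, Finset.sum_empty]; linarith
    obtain ⟨u, huI, hmin⟩ := I.exists_min_image (fun u => L.d v u) hne
    have huS : u ∈ S := (Finset.mem_filter.1 huI).1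
    rw [← Finset.add_sum_erase I _ huI]
    refine add_le_add (min_le_left _ _) ?_
    calc ∑ w ∈ I.erase u, min 1 (L.affectance α β N P v w)
        ≤ ∑ w ∈ I.erase u, transferConst α β * L.affectance α β N P u w := by
          refine Finset.sum_le_sum fun w hw => (min_le_right _ _).trans ?_
          obtain ⟨hwu, hwI⟩ := Finset.mem_erase.1 hw
          have hwS : w ∈ S := (Finset.mem_filter.1 hwI).1
          have := signal_le_transferConst_mul hL hα hβ hN hP hS huS hwS hwu.symm (hmin w hwI)
          unfold affectance
          rw [← mul_div_assoc]
          refine div_le_div_of_nonneg_right ?_ (hslack w hwS).le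
          nlinarith
      _ = transferConst α β * ∑ w ∈ I.erase u, L.affectance α β N P u w := by
          rw [Finset.mul_sum]
      _ ≤ transferConst α β * out u := by
          refine mul_le_mul_of_nonneg_left ?_ hK
          exact Finset.sum_le_sum_of_subset_of_nonneg
            (Finset.erase_subset_erase _ (Finset.filter_subset _ _))
            fun w hw _ => haff u w (Finset.mem_of_mem_erase hw)
      _ ≤ 2 * transferConst α β := by
          have := (Finset.mem_filter.1 huI).2
          nlinarith

/-! ### Links blocked by a profile -/

/-- Indicator of a transmission. -/
def tx (a : Profile n) (i : Fin n) : ℝ := if a i then 1 else 0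

open Classical in
/-- Indicator of a successful transmission. -/
noncomputable def succ (L : LinkSet n) (α β N P : ℝ) (a : Profile n) (i : Fin n) : ℝ :=
  if L.Success α β N P a i then 1 else 0

/-- Indicator that link `i` would succeed if it transmitted against the moves of the others. -/
noncomputable def wouldSucceed (L : LinkSet n) (α β N P : ℝ) (a : Profile n) (i : Fin n) : ℝ :=
  L.succ α β N P (Function.update a i true) i

lemma tx_nonneg (a : Profile n) (i : Fin n) : 0 ≤ tx a i := by
  unfold tx; split_ifs <;> norm_num

lemma succ_nonneg (L : LinkSet n) (α β N P : ℝ) (a : Profile n) (i : Fin n) :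
    0 ≤ L.succ α β N P a i := by
  unfold succ; split_ifs <;> norm_num

lemma succ_le_tx (L : LinkSet n) (α β N P : ℝ) (a : Profile n) (i : Fin n) :
    L.succ α β N P a i ≤ tx a i := by
  unfold succ tx
  by_cases h : L.Success α β N P a i
  · simp [h, h.transmits]
  · simp only [h, if_false]; split_ifs <;> norm_num

/-- A link of positive slack that is blocked is blocked by the truncated affectance of the
transmitting senders. -/
lemma one_sub_wouldSucceed_le_affectance {L : LinkSet n} (hL : L.Normalized) {α β N P : ℝ}
    (hβ : 1 < β) (hN : 0 ≤ N) (hP : 0 < P) (a : Profile n) {i : Fin n}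
    (hslack : 0 < L.signal α P i i - β * N) :
    1 - L.wouldSucceed α β N P a i ≤ ∑ k, tx a k * min 1 (L.affectance α β N P k i) := by
  classical
  have haff : ∀ k, 0 ≤ L.affectance α β N P k i := fun k =>
    div_nonneg (mul_nonneg (by linarith) (hL.signal_pos hP k i).le) hslack.le
  have hterm : ∀ k, 0 ≤ tx a k * min 1 (L.affectance α β N P k i) := fun k =>
    mul_nonneg (tx_nonneg a k) (le_min zero_le_one (haff k))
  unfold wouldSucceed succ
  split_ifs with hsucc
  · simpa using Finset.sum_nonneg fun k _ => hterm k
  have hfail : ¬ β * ((∑ k with k ≠ i ∧ Function.update a i true k = true,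
      L.signal α P k i) + N) ≤ L.signal α P i i := fun h =>
    hsucc (success_of_sinr hL hβ hN hP (by simp) h)
  have hset : (Finset.univ.filter fun k => k ≠ i ∧ Function.update a i true k = true)
      = Finset.univ.filter fun k => k ≠ i ∧ a k = true := by
    ext k
    by_cases hk : k = i <;> simp [hk, Function.update]
  rw [hset, not_le] at hfail
  have hsum : 1 ≤ ∑ k with k ≠ i ∧ a k = true, L.affectance α β N P k i := by
    unfold affectance
    rw [← Finset.sum_div, ← Finset.mul_sum, le_div_iff₀ hslack]
    linarith
  rw [sub_zero]
  by_cases hbig : ∃ k, a k = true ∧ 1 ≤ L.affectance α β N P k i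
  · obtain ⟨k, hk, h1⟩ := hbig
    refine le_trans ?_ (Finset.single_le_sum (fun k _ => hterm k) (Finset.mem_univ k))
    simp [tx, hk, h1]
  · push Not at hbig
    refine hsum.trans ?_
    calc ∑ k with k ≠ i ∧ a k = true, L.affectance α β N P k i
        = ∑ k with k ≠ i ∧ a k = true, tx a k * min 1 (L.affectance α β N P k i) := by
          refine Finset.sum_congr rfl fun k hk => ?_
          have hk' := (Finset.mem_filter.1 hk).2.2
          simp [tx, hk', min_eq_right (hbig k hk').le]
      _ ≤ ∑ k, tx a k * min 1 (L.affectance α β N P k i) :=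
          Finset.sum_le_sum_of_subset_of_nonneg (Finset.filter_subset _ _) fun k _ _ => hterm k

lemma one_sub_wouldSucceed_le_of_alone {L : LinkSet n} (hL : L.Normalized) {α β N P : ℝ}
    (hβ : 1 < β) (hN : 0 ≤ N) (hP : 0 < P) (a : Profile n) {i : Fin n}
    (hi : β * N ≤ L.signal α P i i) :
    1 - L.wouldSucceed α β N P a i ≤ ∑ k ∈ Finset.univ.erase i, tx a k := by
  classical
  have h0 : 0 ≤ ∑ k ∈ Finset.univ.erase i, tx a k := Finset.sum_nonneg fun k _ => tx_nonneg a k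
  unfold wouldSucceed succ
  split_ifs with hsucc
  · simpa using h0
  by_cases hex : ∃ k, k ≠ i ∧ a k = true
  · obtain ⟨k, hki, hk⟩ := hex
    refine le_trans ?_ (Finset.single_le_sum (fun k _ => tx_nonneg a k)
      (Finset.mem_erase.2 ⟨hki, Finset.mem_univ k⟩))
    simp [tx, hk]
  · refine absurd (success_of_sinr hL hβ hN hP (by simp) ?_) hsucc
    have hset : (Finset.univ.filter fun k => k ≠ i ∧ Function.update a i true k = true) = ∅ := by
      refine Finset.filter_eq_empty_iff.2 fun k _ hk => hex ⟨k, hk.1, ?_⟩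
      simpa [Function.update, hk.1] using hk.2
    rw [hset, Finset.sum_empty, zero_add]
    exact hi

/-- Each transmitting sender blocks only a bounded number of links of an amicable set. -/
lemma sum_one_sub_wouldSucceed_le {L : LinkSet n} (hL : L.Normalized) {α β N P : ℝ}
    (hβ : 1 < β) (hN : 0 ≤ N) (hP : 0 < P) {I : Finset (Fin n)} {M : ℝ}
    (hslack : ∀ i ∈ I, 0 < L.signal α P i i - β * N)
    (hM : ∀ v, ∑ w ∈ I, min 1 (L.affectance α β N P v w) ≤ M) (a : Profile n) :
    ∑ i ∈ I, (1 - L.wouldSucceed α β N P a i) ≤ M * ∑ k, tx a k := by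
  calc ∑ i ∈ I, (1 - L.wouldSucceed α β N P a i)
      ≤ ∑ i ∈ I, ∑ k, tx a k * min 1 (L.affectance α β N P k i) :=
        Finset.sum_le_sum fun i hi => one_sub_wouldSucceed_le_affectance hL hβ hN hP a (hslack i hi)
    _ = ∑ k, tx a k * ∑ i ∈ I, min 1 (L.affectance α β N P k i) := by
        rw [Finset.sum_comm]
        simp only [Finset.mul_sum]
    _ ≤ ∑ k, tx a k * M :=
        Finset.sum_le_sum fun k _ => mul_le_mul_of_nonneg_left (hM k) (tx_nonneg a k)
    _ = M * ∑ k, tx a k := by rw [← Finset.sum_mul, mul_comm]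

/-! ### Averages over a history -/

/-- The average over the rounds of a history of a quantity that depends on the profile. -/
noncomputable def avg {T : ℕ} (H : Fin T → Profile n) (f : Profile n → ℝ) : ℝ :=
  (1 / (T : ℝ)) * ∑ t, f (H t)

section Avg

variable {T : ℕ} (H : Fin T → Profile n)

lemma avg_mono {f g : Profile n → ℝ} (h : ∀ a, f a ≤ g a) : avg H f ≤ avg H g :=
  mul_le_mul_of_nonneg_left (Finset.sum_le_sum fun t _ => h (H t)) (by positivity)

lemma avg_nonneg {f : Profile n → ℝ} (h : ∀ a, 0 ≤ f a) : 0 ≤ avg H f :=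
  mul_nonneg (by positivity) (Finset.sum_nonneg fun t _ => h (H t))

lemma avg_sub (f g : Profile n → ℝ) : avg H (fun a => f a - g a) = avg H f - avg H g := by
  simp only [avg, Finset.sum_sub_distrib, mul_sub]

lemma avg_const_mul (c : ℝ) (f : Profile n → ℝ) : avg H (fun a => c * f a) = c * avg H f := by
  simp only [avg, ← Finset.mul_sum]
  ring

lemma avg_sum {ι : Type*} (s : Finset ι) (f : ι → Profile n → ℝ) :
    avg H (fun a => ∑ i ∈ s, f i a) = ∑ i ∈ s, avg H (f i) := by
  simp only [avg, ← Finset.mul_sum]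
  rw [Finset.sum_comm]

lemma avg_const (hT : 0 < T) (c : ℝ) : avg H (fun _ => c) = c := by
  have : (T : ℝ) ≠ 0 := by exact_mod_cast hT.ne'
  simp [avg, this]

end Avg

lemma utility_eq (L : LinkSet n) (α β N P : ℝ) (a : Profile n) (i : Fin n) :
    L.utility α β N P a i = 2 * L.succ α β N P a i - tx a i := by
  unfold utility succ tx
  by_cases h : L.Success α β N P a i
  · simp [h, h.transmits]; norm_num
  · simp only [h, if_false]; split_ifs <;> norm_num

lemma avgSuccess_eq (L : LinkSet n) (α β N P : ℝ) {T : ℕ} (H : Fin T → Profile n) :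
    L.avgSuccess α β N P H = ∑ i, avg H fun a => L.succ α β N P a i := by
  rw [← avg_sum]
  simp [avgSuccess, avg, numSuccess, succ]

section Regret

variable {L : LinkSet n} {α β N P ε : ℝ} {T : ℕ} {H : Fin T → Profile n}

lemma IsRegretHistory.avg_utility_le (h : L.IsRegretHistory α β N P ε H) (i : Fin n) (s : Bool) :
    (avg H fun a => L.utility α β N P (Function.update a i s) i)
      ≤ (2 * avg H fun a => L.succ α β N P a i) - (avg H fun a => tx a i) + ε := by
  have h1 := h i
  have h2 := le_ciSup (f := fun s : Bool =>
    (1 / (T : ℝ)) * ∑ t, L.utility α β N P (Function.update (H t) i s) i)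
    (Set.finite_range _).bddAbove s
  have h3 : (1 / (T : ℝ)) * ∑ t, L.utility α β N P (H t) i
      = (2 * avg H fun a => L.succ α β N P a i) - (avg H fun a => tx a i) := by
    rw [← avg_const_mul, ← avg_sub]
    simp only [avg, utility_eq]
  unfold regret at h1
  rw [h3] at h1
  have h4 : (avg H fun a => L.utility α β N P (Function.update a i s) i)
    = (1 / (T : ℝ)) * ∑ t, L.utility α β N P (Function.update (H t) i s) i := rfl
  rw [h4]
  linarith

/-- Comparison with permanent silence. -/
lemma IsRegretHistory.avg_tx_le (h : L.IsRegretHistory α β N P ε H) (i : Fin n) :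
    (avg H fun a => tx a i) ≤ (2 * avg H fun a => L.succ α β N P a i) + ε := by
  have h1 := h.avg_utility_le i false
  have h2 : (avg H fun a => L.utility α β N P (Function.update a i false) i) = 0 := by
    simp [avg, utility]
  linarith

/-- Comparison with permanent transmission. -/
lemma IsRegretHistory.one_sub_le (h : L.IsRegretHistory α β N P ε H) (hT : 0 < T) (i : Fin n) :
    1 - (2 * avg H fun a => 1 - L.wouldSucceed α β N P a i)
      ≤ (2 * avg H fun a => L.succ α β N P a i) - (avg H fun a => tx a i) + ε := by
  refine le_trans (le_of_eq ?_) (h.avg_utility_le i true)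
  rw [avg_sub, avg_const H hT]
  have : (avg H fun a => L.utility α β N P (Function.update a i true) i)
      = avg H fun a => 2 * L.wouldSucceed α β N P a i - 1 := by
    congr 1
    funext a
    rw [utility_eq]
    simp [wouldSucceed, tx]
  rw [this, avg_sub, avg_const_mul, avg_const H hT]
  ring

lemma avg_succ_le_avg_tx (i : Fin n) :
    (avg H fun a => L.succ α β N P a i) ≤ avg H fun a => tx a i :=
  avg_mono H fun a => L.succ_le_tx α β N P a i

lemma IsRegretHistory.sum_avg_tx_le (h : L.IsRegretHistory α β N P ε H) :
    ∑ i, (avg H fun a => tx a i) ≤ 2 * L.avgSuccess α β N P H + n * ε := by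
  have := Finset.sum_le_sum fun i (_ : i ∈ Finset.univ) => h.avg_tx_le i
  rw [Finset.sum_add_distrib, ← Finset.mul_sum, ← avgSuccess_eq] at this
  simpa using this

/-- If some link can overcome the noise, success is bounded away from `0`: when the others rarely
transmit, silence costs this link regret, and otherwise the transmissions of the others must
succeed. -/
lemma IsRegretHistory.le_avgSuccess (h : L.IsRegretHistory α β N P ε H) (hT : 0 < T)
    (hL : L.Normalized) (hβ : 1 < β) (hN : 0 ≤ N) (hP : 0 < P) {i : Fin n}
    (hi : β * N ≤ L.signal α P i i) :
    (1 / 2 - n * ε) / 2 ≤ L.avgSuccess α β N P H := by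
  have hQ := h.sum_avg_tx_le
  have h1 := h.one_sub_le hT i
  have h2 : (avg H fun a => 1 - L.wouldSucceed α β N P a i)
      ≤ ∑ k ∈ Finset.univ.erase i, avg H fun a => tx a k := by
    rw [← avg_sum]
    exact avg_mono H fun a => one_sub_wouldSucceed_le_of_alone hL hβ hN hP a hi
  have h3 : 2 * L.avgSuccess α β N P H + n * ε
      ≥ (2 * avg H fun a => L.succ α β N P a i) + ε
        + ∑ k ∈ Finset.univ.erase i, avg H fun a => tx a k := by
    have := Finset.sum_le_sum fun k (_ : k ∈ Finset.univ.erase i) => h.avg_tx_le k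
    rw [Finset.sum_add_distrib, ← Finset.mul_sum] at this
    have hs := Finset.add_sum_erase Finset.univ
      (fun k => avg H fun a => L.succ α β N P a k) (Finset.mem_univ i)
    rw [← avgSuccess_eq] at hs
    have hcard : ∑ _k ∈ Finset.univ.erase i, ε = (n : ℝ) * ε - ε := by
      have := Finset.add_sum_erase Finset.univ (fun _ => ε) (Finset.mem_univ i)
      simp only [Finset.sum_const, Finset.card_univ, Fintype.card_fin, nsmul_eq_mul] at this ⊢
      linarith
    rw [hcard] at this
    linarith
  have h4 := Finset.add_sum_erase Finset.univ (fun k => avg H fun a => tx a k) (Finset.mem_univ i)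
  have h5 : 0 ≤ avg H fun a => tx a i := avg_nonneg H fun a => tx_nonneg a i
  linarith

/-- In a history of small regret, an amicable set is not much larger than the average number of
transmissions: a link of it that transmits rarely must be blocked in a constant fraction of the
rounds. -/
lemma IsRegretHistory.card_amicable_le (h : L.IsRegretHistory α β N P ε H) (hT : 0 < T)
    (hL : L.Normalized) (hβ : 1 < β) (hN : 0 ≤ N) (hP : 0 < P) (hε : ε ≤ 1 / 2)
    {I : Finset (Fin n)} {M : ℝ} (hslack : ∀ i ∈ I, 0 < L.signal α P i i - β * N)
    (hM : ∀ v, ∑ w ∈ I, min 1 (L.affectance α β N P v w) ≤ M) :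
    (I.card : ℝ) ≤ (2 + 4 * M) * ∑ i, avg H fun a => tx a i := by
  have h1 : ∀ i ∈ I, 1 / 2 ≤ (2 * avg H fun a => 1 - L.wouldSucceed α β N P a i)
      + avg H fun a => tx a i := fun i _ => by
    have := h.one_sub_le hT i
    have := avg_succ_le_avg_tx (L := L) (α := α) (β := β) (N := N) (P := P) (H := H) i
    linarith
  have h2 := Finset.sum_le_sum h1
  rw [Finset.sum_add_distrib, ← Finset.mul_sum, ← avg_sum] at h2
  have h3 : (avg H fun a => ∑ i ∈ I, (1 - L.wouldSucceed α β N P a i))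
      ≤ M * ∑ i, avg H fun a => tx a i := by
    rw [← avg_sum, ← avg_const_mul]
    exact avg_mono H fun a => sum_one_sub_wouldSucceed_le hL hβ hN hP hslack hM a
  have h4 : ∑ i ∈ I, (avg H fun a => tx a i) ≤ ∑ i, avg H fun a => tx a i :=
    Finset.sum_le_sum_of_subset_of_nonneg (Finset.subset_univ _)
      fun i _ _ => avg_nonneg H fun a => tx_nonneg a i
  simp only [Finset.sum_const, nsmul_eq_mul] at h2
  linarith

end Regret

/-! ### The upper bound -/

/-- In a plainly feasible set of at least two links every link has positive slack. -/
lemma PlainFeasible.slack_pos {L : LinkSet n} (hL : L.Normalized) {α β N P : ℝ}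
    (hβ : 1 < β) (hP : 0 < P) {S : Finset (Fin n)} (hS : L.PlainFeasible α β N P S)
    (hcard : 1 < S.card) {i : Fin n} (hi : i ∈ S) : 0 < L.signal α P i i - β * N := by
  classical
  obtain ⟨j, hj, hji⟩ := Finset.exists_mem_ne hcard i
  have hle : L.signal α P j i ≤ ∑ k ∈ S.erase i, L.signal α P k i :=
    Finset.single_le_sum (f := fun k => L.signal α P k i)
      (fun k _ => (hL.signal_pos hP k i).le) (Finset.mem_erase.2 ⟨hji, hj⟩)
  have := hS i hi
  have := hL.signal_pos (α := α) hP j i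
  nlinarith

lemma exists_feasible_card_eq_opt (L : LinkSet n) (α β N P : ℝ) :
    ∃ S, L.Feasible α β N P S ∧ S.card = L.opt α β N P := by
  classical
  obtain ⟨S, hS, hcard⟩ := Finset.exists_mem_eq_sup
    (Finset.univ.filter fun S : Finset (Fin n) => L.Feasible α β N P S)
    ⟨∅, Finset.mem_filter.2 ⟨Finset.mem_univ _, by simp [Feasible]⟩⟩ Finset.card
  exact ⟨S, (Finset.mem_filter.1 hS).2, hcard.symm⟩

/-- The constant relating a plainly feasible set to the average number of successes. -/
noncomputable def plainConst (α β κ : ℝ) : ℝ :=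
  (2 + 1 / (1 / 2 - κ)) * (2 * (2 + 4 * (1 + 2 * transferConst α β)))

lemma IsRegretHistory.card_plainFeasible_le {L : LinkSet n} (hL : L.Normalized)
    {α β N P ε κ : ℝ} (hα : 0 < α) (hβ : 1 < β) (hN : 0 ≤ N) (hP : 0 < P)
    (hκ : κ < 1 / 2) (hnε : n * ε ≤ κ) {T : ℕ} (hT : 0 < T)
    {H : Fin T → Profile n} (h : L.IsRegretHistory α β N P ε H) {S : Finset (Fin n)}
    (hS : L.PlainFeasible α β N P S) :
    (S.card : ℝ) ≤ plainConst α β κ * L.avgSuccess α β N P H := by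
  have hK := transferConst_nonneg hα hβ
  have hδ : 0 < 1 / 2 - κ := by linarith
  have hinv : 0 < 1 / (1 / 2 - κ) := by positivity
  have hS0 : 0 ≤ L.avgSuccess α β N P H := by
    rw [avgSuccess_eq]
    exact Finset.sum_nonneg fun i _ => avg_nonneg H fun a => L.succ_nonneg α β N P a i
  rcases S.eq_empty_or_nonempty with rfl | ⟨i, hi⟩
  · rw [Finset.card_empty, Nat.cast_zero, plainConst]
    positivity
  have hlow : (1 / 2 - κ) / 2 ≤ L.avgSuccess α β N P H := by
    refine le_trans ?_ (h.le_avgSuccess hT hL hβ hN hP (i := i) ?_)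
    · linarith
    · have := hS i hi
      have hsum : 0 ≤ ∑ k ∈ S.erase i, L.signal α P k i :=
        Finset.sum_nonneg fun k _ => (hL.signal_pos hP k i).le
      nlinarith
  have hlow' : 1 ≤ 2 * (1 / (1 / 2 - κ)) * L.avgSuccess α β N P H := by
    calc (1 : ℝ) = 2 * (1 / (1 / 2 - κ)) * ((1 / 2 - κ) / 2) := by
          linarith [one_div_mul_cancel hδ.ne']
      _ ≤ _ := by gcongr
  rcases le_or_gt S.card 1 with hone | htwo
  · have hone' : (S.card : ℝ) ≤ 1 := by exact_mod_cast hone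
    refine hone'.trans (hlow'.trans (mul_le_mul_of_nonneg_right ?_ hS0))
    unfold plainConst
    nlinarith [mul_nonneg hinv.le hK]
  · have hslack : ∀ i ∈ S, 0 < L.signal α P i i - β * N := fun i hi =>
      hS.slack_pos hL hβ hP htwo hi
    obtain ⟨I, hIS, hcard, hM⟩ := hS.exists_amicable hL hα hβ hN hP hslack
    have hn : (1 : ℝ) ≤ n := by
      have : 0 < n := i.pos
      exact_mod_cast this
    have hε2 : ε ≤ 1 / 2 := by nlinarith
    have h1 := h.card_amicable_le hT hL hβ hN hP hε2 (fun i hi => hslack i (hIS hi)) hM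
    have h2 : ∑ i, (avg H fun a => tx a i)
        ≤ (2 + 1 / (1 / 2 - κ)) * L.avgSuccess α β N P H := by
      have := h.sum_avg_tx_le
      nlinarith
    have hcard' : (S.card : ℝ) ≤ 2 * I.card := by exact_mod_cast hcard
    calc (S.card : ℝ) ≤ 2 * I.card := hcard'
      _ ≤ 2 * ((2 + 4 * (1 + 2 * transferConst α β)) * ∑ i, avg H fun a => tx a i) := by gcongr
      _ ≤ 2 * ((2 + 4 * (1 + 2 * transferConst α β))
            * ((2 + 1 / (1 / 2 - κ)) * L.avgSuccess α β N P H)) := by gcongr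
      _ = plainConst α β κ * L.avgSuccess α β N P H := by unfold plainConst; ring

/-- The constant of the upper bound. -/
noncomputable def upperConst (α β κ : ℝ) : ℝ :=
  (2 * (α / Real.log β) + 1) * plainConst α β κ

lemma upperConst_pos {α β κ : ℝ} (hα : 0 < α) (hβ : 1 < β) (hκ : κ < 1 / 2) :
    0 < upperConst α β κ := by
  have hK := transferConst_nonneg hα hβ
  have := Real.log_pos hβ
  have hδ : 0 < 1 / 2 - κ := by linarith
  unfold upperConst plainConst
  positivity

theorem priceOfTotalAnarchy_le {L : LinkSet n} (hL : L.Normalized)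
    {α β N P ε κ : ℝ} (hα : 0 < α) (hβ : 1 < β) (hN : 0 ≤ N) (hP : 0 < P)
    (hκ : κ < 1 / 2) (hnε : n * ε ≤ κ) :
    L.priceOfTotalAnarchy α β N P ε
      ≤ ENNReal.ofReal (upperConst α β κ * (1 + Real.log L.delta)) := by
  have hlog : 0 ≤ Real.log L.delta := Real.log_nonneg hL.one_le_delta
  have hlogβ := Real.log_pos hβ
  have hC := upperConst_pos hα hβ hκ
  have hC0 : 0 < upperConst α β κ * (1 + Real.log L.delta) := by positivity
  obtain ⟨S, hS, hcard⟩ := L.exists_feasible_card_eq_opt α β N P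
  unfold priceOfTotalAnarchy
  rw [ENNReal.div_le_iff_le_mul (Or.inr ENNReal.ofReal_ne_top)
    (Or.inr (ENNReal.ofReal_pos.2 hC0).ne')]
  unfold nMin
  simp only [ENNReal.mul_iInf_of_ne (ENNReal.ofReal_pos.2 hC0).ne' ENNReal.ofReal_ne_top]
  refine le_iInf fun T => le_iInf fun hT => le_iInf fun H => le_iInf fun h => ?_
  rw [← ENNReal.ofReal_mul hC0.le, ← ENNReal.ofReal_natCast]
  refine ENNReal.ofReal_le_ofReal ?_
  obtain ⟨I, -, hI, hplain⟩ := hS.exists_plainFeasible hL hα hβ hN hP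
  have h1 := h.card_plainFeasible_le hL hα hβ hN hP hκ hnε hT hplain
  have hS0 : 0 ≤ L.avgSuccess α β N P H := by
    rw [avgSuccess_eq]
    exact Finset.sum_nonneg fun i _ => avg_nonneg H fun a => L.succ_nonneg α β N P a i
  have hfac : 2 * (α * Real.log L.delta / Real.log β) + 1
      ≤ (2 * (α / Real.log β) + 1) * (1 + Real.log L.delta) := by
    have : 0 ≤ α / Real.log β := by positivity
    rw [mul_div_right_comm]
    nlinarith
  rw [← hcard]
  calc (S.card : ℝ) ≤ (2 * (α * Real.log L.delta / Real.log β) + 1) * I.card := hI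
    _ ≤ ((2 * (α / Real.log β) + 1) * (1 + Real.log L.delta))
        * (plainConst α β κ * L.avgSuccess α β N P H) := by gcongr
    _ = upperConst α β κ * (1 + Real.log L.delta) * L.avgSuccess α β N P H := by
        unfold upperConst; ring

end LinkSet

/-! ### The lower bound -/

lemma dist_plane (a b c d : ℝ) :
    dist (!₂[a, b] : Plane) !₂[c, d] = √((a - c) ^ 2 + (b - d) ^ 2) := by
  simp [EuclideanSpace.dist_eq, Fin.sum_univ_two, Real.dist_eq, sq_abs]

namespace LinkSet

variable {n m : ℕ}

/-- Of two equally strong signals neither can be decoded. -/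
lemma not_canDecode_of_tie {L : LinkSet n} {α β N P : ℝ} (hL : L.Normalized) (hβ : 1 < β)
    (hN : 0 ≤ N) (hP : 0 < P) {a : Profile n} {j k l : Fin n} (hkl : k ≠ l)
    (hpos : 0 < L.received α (power P a) k j)
    (heq : L.received α (power P a) k j = L.received α (power P a) l j) :
    ¬ L.CanDecode α β N (power P a) j k := by
  classical
  intro h
  cases h with
  | intro _ _ hr _ =>
    have hrec : ∀ k, 0 ≤ L.received α (power P a) k j := fun k => by
      rw [received_power]; split_ifs
      · exact (hL.signal_pos hP k j).le
      · exact le_rfl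
    have : L.received α (power P a) l j ≤ L.residual α (power P a) k j :=
      Finset.single_le_sum (f := fun k => L.received α (power P a) k j)
        (fun k _ => hrec k) (by simp [hkl.symm, heq])
    nlinarith

/-- A signal that is no stronger than each of two tied signals is lost. -/
lemma not_canDecode_of_le_tie {L : LinkSet n} {α β N P : ℝ} (hL : L.Normalized) (hβ : 1 < β)
    (hN : 0 ≤ N) (hP : 0 < P) {a : Profile n} {i j k l : Fin n} (hik : i ≠ k) (hkl : k ≠ l)
    (hpos : 0 < L.received α (power P a) i j)
    (heq : L.received α (power P a) k j = L.received α (power P a) l j)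
    (hle : L.received α (power P a) i j ≤ L.received α (power P a) k j) :
    ¬ L.CanDecode α β N (power P a) j i := by
  rcases hle.eq_or_lt with h | h
  · exact not_canDecode_of_tie hL hβ hN hP hik hpos h
  · intro hi
    cases hi with
    | intro _ _ _ hs =>
      exact not_canDecode_of_tie hL hβ hN hP hkl (hpos.trans h) heq (hs k h)

/-- Two jammers of length `1` with senders at `(± R, 0)` and receivers pointing away from the
origin, and `m` links with a common receiver, the origin, and senders `(0, D j)`. -/
noncomputable def jammedTower (R : ℝ) (D : Fin m → ℝ) : LinkSet (m + 2) where
  sender := Fin.cons !₂[R, 0] (Fin.cons !₂[-R, 0] fun j => !₂[0, D j])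
  receiver := Fin.cons !₂[R + 1, 0] (Fin.cons !₂[-(R + 1), 0] fun _ => !₂[0, 0])

/-- The profile in which exactly the two jammers transmit. -/
def jam (m : ℕ) : Profile (m + 2) := Fin.cons true (Fin.cons true fun _ => false)

/-- The profile in which exactly the jammers are silent. -/
def tower (m : ℕ) : Profile (m + 2) := Fin.cons false (Fin.cons false fun _ => true)

section JammedTower

variable {R : ℝ} {D : Fin m → ℝ}

lemma jammedTower_d_zero_zero : (jammedTower R D).d 0 0 = 1 := by
  simp [d, jammedTower, dist_plane]

lemma jammedTower_d_one_one : (jammedTower R D).d (Fin.succ 0) (Fin.succ 0) = 1 := by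
  simp only [d, jammedTower, Fin.cons_succ, Fin.cons_zero, dist_plane]
  ring_nf
  simp

lemma jammedTower_d_zero_one (hR : 1 ≤ R) :
    (jammedTower R D).d 0 (Fin.succ 0) = 2 * R + 1 := by
  simp only [d, jammedTower, Fin.cons_succ, Fin.cons_zero, dist_plane]
  rw [show (R - -(R + 1)) ^ 2 + (0 - 0 : ℝ) ^ 2 = (2 * R + 1) ^ 2 by ring]
  exact Real.sqrt_sq (by linarith)

lemma jammedTower_d_one_zero (hR : 1 ≤ R) :
    (jammedTower R D).d (Fin.succ 0) 0 = 2 * R + 1 := by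
  simp only [d, jammedTower, Fin.cons_succ, Fin.cons_zero, dist_plane]
  rw [show (-R - (R + 1)) ^ 2 + (0 - 0 : ℝ) ^ 2 = (2 * R + 1) ^ 2 by ring]
  exact Real.sqrt_sq (by linarith)

lemma jammedTower_d_zero_tower (hR : 1 ≤ R) (j : Fin m) :
    (jammedTower R D).d 0 j.succ.succ = R := by
  simp only [d, jammedTower, Fin.cons_succ, Fin.cons_zero, dist_plane]
  rw [show (R - 0) ^ 2 + (0 - 0 : ℝ) ^ 2 = R ^ 2 by ring]
  exact Real.sqrt_sq (by linarith)

lemma jammedTower_d_one_tower (hR : 1 ≤ R) (j : Fin m) :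
    (jammedTower R D).d (Fin.succ 0) j.succ.succ = R := by
  simp only [d, jammedTower, Fin.cons_succ, Fin.cons_zero, dist_plane]
  rw [show (-R - 0) ^ 2 + (0 - 0 : ℝ) ^ 2 = R ^ 2 by ring]
  exact Real.sqrt_sq (by linarith)

lemma jammedTower_d_tower_tower (hR : 1 ≤ R) (hD : ∀ j, R ≤ D j) (i j : Fin m) :
    (jammedTower R D).d i.succ.succ j.succ.succ = D i := by
  simp only [d, jammedTower, Fin.cons_succ, dist_plane]
  rw [show (0 - 0 : ℝ) ^ 2 + (D i - 0) ^ 2 = D i ^ 2 by ring]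
  exact Real.sqrt_sq (by linarith [hD i])

lemma one_le_jammedTower_d_tower_zero (hR : 1 ≤ R) (i : Fin m) :
    1 ≤ (jammedTower R D).d i.succ.succ 0 := by
  simp only [d, jammedTower, Fin.cons_succ, Fin.cons_zero, dist_plane]
  exact Real.one_le_sqrt.2 (by nlinarith [sq_nonneg (D i - 0)])

lemma one_le_jammedTower_d_tower_one (hR : 1 ≤ R) (i : Fin m) :
    1 ≤ (jammedTower R D).d i.succ.succ (Fin.succ 0) := by
  simp only [d, jammedTower, Fin.cons_succ, Fin.cons_zero, dist_plane]
  exact Real.one_le_sqrt.2 (by nlinarith [sq_nonneg (D i - 0)])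

lemma jammedTower_normalized (hR : 1 ≤ R) (hD : ∀ j, R ≤ D j) :
    (jammedTower R D).Normalized := by
  refine ⟨?_, 0, 0, jammedTower_d_zero_zero⟩
  simp only [Fin.forall_fin_succ (n := m + 1), Fin.forall_fin_succ (n := m)]
  refine ⟨⟨jammedTower_d_zero_zero.ge, ?_, fun j => ?_⟩, ⟨?_, jammedTower_d_one_one.ge, fun j => ?_⟩,
    fun i => ⟨one_le_jammedTower_d_tower_zero hR i, one_le_jammedTower_d_tower_one hR i,
      fun j => ?_⟩⟩
  · rw [jammedTower_d_zero_one hR]; linarith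
  · rw [jammedTower_d_zero_tower hR]; exact hR
  · rw [jammedTower_d_one_zero hR]; linarith
  · rw [jammedTower_d_one_tower hR]; exact hR
  · rw [jammedTower_d_tower_tower hR hD]; exact hR.trans (hD i)

lemma jammedTower_delta (hR : 1 ≤ R) (hD : ∀ j, R ≤ D j) {Δ : ℝ} (hmax : ∀ j, D j ≤ Δ)
    {j₀ : Fin m} (hj₀ : D j₀ = Δ) : (jammedTower R D).delta = Δ := by
  apply le_antisymm
  · have hΔ : 1 ≤ Δ := by linarith [hD j₀]
    refine ciSup_le ?_
    simp only [Fin.forall_fin_succ (n := m + 1), Fin.forall_fin_succ (n := m)]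
    refine ⟨jammedTower_d_zero_zero.trans_le hΔ, jammedTower_d_one_one.trans_le hΔ, fun j => ?_⟩
    rw [jammedTower_d_tower_tower hR hD]
    exact hmax j
  · have := (jammedTower R D).d_le_delta j₀.succ.succ
    rwa [jammedTower_d_tower_tower hR hD, hj₀] at this

variable {α β N P : ℝ}

/-- The jammers tolerate each other. -/
lemma jammedTower_success_jam (hα : 0 < α) (hβ : 1 < β) (hN : 0 ≤ N) (hP : 0 < P)
    (hR : 1 ≤ R) (hD : ∀ j, R ≤ D j) (hRβ : R ^ α = 2 * β) (hNP : 2 * β * N ≤ P)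
    {i : Fin (m + 2)} (hi : jam m i = true) :
    (jammedTower R D).Success α β N P (jam m) i := by
  classical
  have hL := jammedTower_normalized hR hD
  refine success_of_sinr hL hβ hN hP hi ?_
  have hfar : 2 * β ≤ (2 * R + 1) ^ α := by
    rw [← hRβ]
    exact Real.rpow_le_rpow (by linarith) (by linarith) hα.le
  have hint : β * (P / (2 * R + 1) ^ α + N) ≤ P := by
    have h1 : P / (2 * R + 1) ^ α ≤ P / (2 * β) := by gcongr
    have h2 : β * (P / (2 * β)) = P / 2 := by field_simp
    nlinarith
  revert hi
  refine Fin.cases ?_ (fun i => Fin.cases ?_ (fun i => ?_) i) i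
  · intro _
    simp only [Finset.sum_filter, Fin.sum_univ_succ (n := m + 1), Fin.sum_univ_succ (n := m)]
    simp only [jam, signal, Fin.cons_succ, Fin.cons_zero, ne_eq, not_true_eq_false, false_and,
      if_false, Fin.succ_ne_zero, not_false_eq_true, true_and, if_true, and_false,
      Bool.false_eq_true, Finset.sum_const_zero, jammedTower_d_one_zero hR,
      jammedTower_d_zero_zero, Real.one_rpow, div_one, zero_add, add_zero]
    exact hint
  · intro _
    simp only [Finset.sum_filter, Fin.sum_univ_succ (n := m + 1), Fin.sum_univ_succ (n := m)]
    simp only [jam, signal, Fin.cons_succ, Fin.cons_zero, ne_eq, not_true_eq_false, false_and,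
      if_false, (Fin.succ_ne_zero _).symm, not_false_eq_true, true_and, if_true, and_false,
      Bool.false_eq_true, Finset.sum_const_zero, jammedTower_d_zero_one hR,
      jammedTower_d_one_one, Real.one_rpow, div_one, add_zero]
    exact hint
  · intro hi
    simp [jam] at hi

/-- At the origin the two jammers tie and are stronger than the tower, so that no link of the
tower can be decoded there. -/
lemma jammedTower_not_success_tower (hα : 0 < α) (hβ : 1 < β) (hN : 0 ≤ N) (hP : 0 < P)
    (hR : 1 ≤ R) (hD : ∀ j, R ≤ D j) (j : Fin m) :
    ¬ (jammedTower R D).Success α β N P (Function.update (jam m) j.succ.succ true)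
      j.succ.succ := by
  have hL := jammedTower_normalized hR hD
  have h0 : Function.update (jam m) j.succ.succ true 0 = true := by
    simp [Function.update, jam, (Fin.succ_ne_zero _).symm]
  have h1 : Function.update (jam m) j.succ.succ true (Fin.succ 0) = true := by
    simp only [Function.update, jam, Fin.succ_inj, (Fin.succ_ne_zero _).symm, dite_false,
      Fin.cons_succ, Fin.cons_zero]
  refine not_canDecode_of_le_tie hL hβ hN hP (k := 0) (l := Fin.succ 0) (Fin.succ_ne_zero _)
    (Fin.succ_ne_zero _).symm ?_ ?_ ?_ <;> simp only [received_power, h0, h1, if_true,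
      Function.update_self, signal, jammedTower_d_zero_tower hR, jammedTower_d_one_tower hR,
      jammedTower_d_tower_tower hR hD]
  · have : 0 < D j := by linarith [hD j]
    positivity
  · have hR0 : 0 < R := by linarith
    have := hD j
    gcongr

lemma jammedTower_isPureNash (hα : 0 < α) (hβ : 1 < β) (hN : 0 ≤ N) (hP : 0 < P)
    (hR : 1 ≤ R) (hD : ∀ j, R ≤ D j) (hRβ : R ^ α = 2 * β) (hNP : 2 * β * N ≤ P) :
    (jammedTower R D).IsPureNash α β N P (jam m) := by
  intro i s
  cases hi : jam m i with
  | true =>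
    have hs := jammedTower_success_jam hα hβ hN hP hR hD hRβ hNP hi
    have : (jammedTower R D).utility α β N P (jam m) i = 1 := by
      simp [utility, hi, hs]
    rw [this]
    unfold utility
    split_ifs <;> norm_num
  | false =>
    have h0 : (jammedTower R D).utility α β N P (jam m) i = 0 := by
      simp [utility, hi]
    rw [h0]
    cases s with
    | false => simp [utility]
    | true =>
      revert hi
      refine Fin.cases ?_ (fun i => Fin.cases ?_ (fun i => ?_) i) i
      · intro hi; simp [jam] at hi
      · intro hi
        simp only [jam, Fin.cons_succ, Fin.cons_zero] at hi
        exact absurd hi (by decide)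
      · intro _
        have := jammedTower_not_success_tower hα hβ hN hP hR hD i
        simp [utility, this]

lemma jammedTower_numSuccess_le :
    (jammedTower R D).numSuccess α β N P (jam m) ≤ 2 := by
  classical
  have h1 : (jammedTower R D).numSuccess α β N P (jam m)
      ≤ (Finset.univ.filter fun i => jam m i = true).card := by
    refine Finset.card_le_card fun i hi => ?_
    exact Finset.mem_filter.2 ⟨Finset.mem_univ _, (Finset.mem_filter.1 hi).2.transmits⟩
  refine h1.trans (le_of_eq ?_)
  rw [Finset.card_filter, Fin.sum_univ_succ, Fin.sum_univ_succ]
  simp only [jam, Fin.cons_succ, Fin.cons_zero, if_true, Bool.false_eq_true, if_false,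
    Finset.sum_const_zero]
  norm_num

/-- When the signals of the tower grow geometrically, at the rate `2 * β + 1`, they can be decoded
and cancelled one after another, from the strongest down. -/
lemma jammedTower_canDecode_tower (hβ : 1 < β) (hP : 0 < P)
    (hR : 1 ≤ R) (hD : ∀ j, R ≤ D j) {B : ℝ} (hB : 0 < B) (hNB : 2 * β * N ≤ B)
    (hgeom : ∀ j, P / D j ^ α = B * (2 * β + 1) ^ (j : ℕ)) (r j : Fin m) :
    (jammedTower R D).CanDecode α β N (power P (tower m)) r.succ.succ j.succ.succ := by
  classical
  have hrec : ∀ i : Fin m, (jammedTower R D).received α (power P (tower m)) i.succ.succ r.succ.succ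
      = B * (2 * β + 1) ^ (i : ℕ) := fun i => by
    rw [received_power]
    simp only [tower, Fin.cons_succ, if_true, signal, jammedTower_d_tower_tower hR hD, hgeom]
  have hrec0 : (jammedTower R D).received α (power P (tower m)) 0 r.succ.succ = 0 := by
    rw [received_power]
    simp [tower]
  have hrec1 : (jammedTower R D).received α (power P (tower m)) (Fin.succ 0) r.succ.succ = 0 := by
    rw [received_power]
    simp only [tower, Fin.cons_succ, Fin.cons_zero, Bool.false_eq_true, if_false]
  have hx : 1 < 2 * β + 1 := by linarith
  have hmono : ∀ i k : Fin m, B * (2 * β + 1) ^ (i : ℕ) ≤ B * (2 * β + 1) ^ (k : ℕ) → i ≤ k := by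
    intro i k h
    exact (pow_le_pow_iff_right₀ hx).1 (le_of_mul_le_mul_left h hB)
  induction hk : m - (j : ℕ) using Nat.strong_induction_on generalizing j with
  | _ k ih =>
  subst hk
  refine CanDecode.intro _ ?_ ?_ ?_
  · simpa [power, tower] using hP
  · rw [hrec]
    have hres : (jammedTower R D).residual α (power P (tower m)) j.succ.succ r.succ.succ
        ≤ B * ∑ i ∈ Finset.range (j : ℕ), (2 * β + 1) ^ i := by
      unfold residual
      simp only [Finset.sum_filter, Fin.sum_univ_succ (n := m + 1), Fin.sum_univ_succ (n := m),
        hrec, hrec0, hrec1, ite_self, zero_add]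
      calc ∑ i : Fin m, (if i.succ.succ ≠ j.succ.succ ∧
              B * (2 * β + 1) ^ (i : ℕ) ≤ B * (2 * β + 1) ^ (j : ℕ)
              then B * (2 * β + 1) ^ (i : ℕ) else 0)
          ≤ ∑ i : Fin m, (if (i : ℕ) < j then B * (2 * β + 1) ^ (i : ℕ) else 0) := by
            refine Finset.sum_le_sum fun i _ => ?_
            split_ifs with h1 h2 h2
            · exact le_rfl
            · refine absurd (lt_of_le_of_ne (hmono i j h1.2) ?_) h2
              rintro rfl
              exact h1.1 rfl
            · positivity
            · exact le_rfl
        _ = ∑ i ∈ Finset.range m, (if i < j then B * (2 * β + 1) ^ i else 0) :=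
            Fin.sum_univ_eq_sum_range
              (fun i => if i < (j : ℕ) then B * (2 * β + 1) ^ i else 0) m
        _ = ∑ i ∈ Finset.range (j : ℕ), B * (2 * β + 1) ^ i := by
            rw [← Finset.sum_filter]
            congr 1
            ext i
            simp only [Finset.mem_filter, Finset.mem_range]
            have := j.2
            omega
        _ = _ := by rw [Finset.mul_sum]
    have hsum := geom_sum_mul (2 * β + 1) (j : ℕ)
    calc β * ((jammedTower R D).residual α (power P (tower m)) j.succ.succ r.succ.succ + N)
        ≤ β * (B * ∑ i ∈ Finset.range (j : ℕ), (2 * β + 1) ^ i + N) := by gcongr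
      _ = B * ((2 * β + 1) ^ (j : ℕ) - 1) / 2 + β * N := by rw [← hsum]; ring
      _ ≤ B * (2 * β + 1) ^ (j : ℕ) := by
        have : 0 < B * (2 * β + 1) ^ (j : ℕ) := by positivity
        linarith
  · simp only [Fin.forall_fin_succ (n := m + 1), Fin.forall_fin_succ (n := m), hrec, hrec0, hrec1]
    have hpos : 0 ≤ B * (2 * β + 1) ^ (j : ℕ) := by positivity
    refine ⟨fun h => absurd h hpos.not_gt, fun h => absurd h hpos.not_gt, fun i h => ?_⟩
    refine ih _ ?_ i rfl
    have hij : j < i := by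
      by_contra hcon
      refine h.not_ge (mul_le_mul_of_nonneg_left (pow_le_pow_right₀ hx.le ?_) hB.le)
      exact not_lt.1 hcon
    have := i.2
    have : (j : ℕ) < i := hij
    omega

lemma card_le_opt {L : LinkSet n} {S : Finset (Fin n)} (hS : L.Feasible α β N P S) :
    S.card ≤ L.opt α β N P := by
  classical
  exact Finset.le_sup (f := Finset.card) (Finset.mem_filter.2 ⟨Finset.mem_univ S, hS⟩)

lemma le_jammedTower_opt (hβ : 1 < β) (hP : 0 < P)
    (hR : 1 ≤ R) (hD : ∀ j, R ≤ D j) {B : ℝ} (hB : 0 < B) (hNB : 2 * β * N ≤ B)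
    (hgeom : ∀ j, P / D j ^ α = B * (2 * β + 1) ^ (j : ℕ)) :
    m ≤ (jammedTower R D).opt α β N P := by
  have hprof : (fun k => decide (k ∈ Finset.univ.filter fun k => tower m k = true)) = tower m := by
    funext k
    simp
  have hcard : (Finset.univ.filter fun k => tower m k = true).card = m := by
    rw [Finset.card_filter, Fin.sum_univ_succ, Fin.sum_univ_succ]
    simp [tower]
  have hfeas : (jammedTower R D).Feasible α β N P
      (Finset.univ.filter fun k => tower m k = true) := by
    intro i hi
    rw [hprof]
    have hi' := (Finset.mem_filter.1 hi).2
    clear hi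
    revert hi'
    refine Fin.cases ?_ (fun i => Fin.cases ?_ (fun i => ?_) i) i
    · intro h; simp [tower] at h
    · intro h
      simp only [tower, Fin.cons_succ, Fin.cons_zero] at h
      exact absurd h (by decide)
    · intro _
      exact jammedTower_canDecode_tower hβ hP hR hD hB hNB hgeom i i
  exact hcard.symm.le.trans (card_le_opt hfeas)

end JammedTower

/-- A pure Nash equilibrium, repeated, is a history without regret. -/
lemma IsPureNash.nMin_le {L : LinkSet n} {α β N P ε : ℝ} {a : Profile n}
    (ha : L.IsPureNash α β N P a) (hε : 0 ≤ ε) :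
    L.nMin α β N P ε ≤ L.numSuccess α β N P a := by
  have hreg : L.IsRegretHistory α β N P ε (fun _ : Fin 1 => a) := by
    intro i
    have : (⨆ s : Bool, L.utility α β N P (Function.update a i s) i) ≤ L.utility α β N P a i :=
      ciSup_le (ha i)
    simp only [regret, Nat.cast_one, div_one, one_mul, Finset.univ_unique, Finset.sum_singleton]
    linarith
  refine (iInf₂_le 1 one_pos).trans ((iInf₂_le (fun _ : Fin 1 => a) hreg).trans (le_of_eq ?_))
  simp [avgSuccess]

lemma IsPureNash.le_priceOfTotalAnarchy {L : LinkSet n} {α β N P ε x : ℝ} {a : Profile n}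
    (ha : L.IsPureNash α β N P a) (hε : 0 ≤ ε) (hpos : 0 < L.numSuccess α β N P a)
    (hx : x * L.numSuccess α β N P a ≤ L.opt α β N P) :
    ENNReal.ofReal x ≤ L.priceOfTotalAnarchy α β N P ε := by
  unfold priceOfTotalAnarchy
  refine le_trans ?_ (ENNReal.div_le_div_left (ha.nMin_le hε) _)
  rw [ENNReal.le_div_iff_mul_le (Or.inl (by exact_mod_cast hpos.ne'))
    (Or.inl (ENNReal.natCast_ne_top _)), ← ENNReal.ofReal_natCast, ← ENNReal.ofReal_natCast,
    ← ENNReal.ofReal_mul' (Nat.cast_nonneg _)]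
  exact ENNReal.ofReal_le_ofReal hx

/-- The lower bound: the lengths of the tower run through a geometric progression from `Δ` down to
the distance of the jammers. -/
theorem exists_bad_pureNash {α β : ℝ} (hα : 0 < α) (hβ : 1 < β) :
    ∃ c Δ₀ : ℝ, 0 < c ∧ 1 < Δ₀ ∧ ∀ N Δ : ℝ, 0 ≤ N → Δ₀ ≤ Δ →
      ∃ P₀ : ℝ, 0 < P₀ ∧ ∀ P : ℝ, P₀ ≤ P →
      ∃ (n : ℕ) (L : LinkSet n) (a : Profile n), L.Normalized ∧ L.delta = Δ ∧
        L.IsPureNash α β N P a ∧ 0 < L.numSuccess α β N P a ∧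
        c * Real.log Δ * (L.numSuccess α β N P a : ℝ) ≤ (L.opt α β N P : ℝ) := by
  have hβ0 : 0 ≤ 2 * β := by linarith
  have hx0 : 0 ≤ 2 * β + 1 := by linarith
  set R := (2 * β) ^ (1 / α) with hRdef
  set q := (2 * β + 1) ^ (1 / α) with hqdef
  have hR : 1 < R := Real.one_lt_rpow (by linarith) (by positivity)
  have hq : 1 < q := Real.one_lt_rpow (by linarith) (by positivity)
  have hRα : R ^ α = 2 * β := by
    rw [hRdef, ← Real.rpow_mul hβ0, one_div, inv_mul_cancel₀ hα.ne', Real.rpow_one]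
  have hqα : q ^ α = 2 * β + 1 := by
    rw [hqdef, ← Real.rpow_mul hx0, one_div, inv_mul_cancel₀ hα.ne', Real.rpow_one]
  have hlogq := Real.log_pos hq
  refine ⟨1 / (4 * Real.log q), R ^ 2, by positivity, one_lt_pow₀ hR two_ne_zero,
    fun N Δ hN hΔ => ?_⟩
  have hR0 : 0 < R := by linarith
  have hΔ1 : 1 ≤ Δ := (one_le_pow₀ hR.le).trans hΔ
  have hΔ0 : 0 < Δ := by linarith
  have hΔα : 1 ≤ Δ ^ α := Real.one_le_rpow hΔ1 hα.le
  have hRΔ : R ≤ Δ := by nlinarith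
  refine ⟨2 * β * N * Δ ^ α + 1, by positivity, fun P hP => ?_⟩
  have hNΔ : 2 * β * N ≤ 2 * β * N * Δ ^ α := le_mul_of_one_le_right (by positivity) hΔα
  have hNP : 2 * β * N ≤ P := by linarith
  have hP0 : 0 < P := by
    have : 0 ≤ 2 * β * N := by positivity
    linarith
  set m := ⌊Real.log (Δ / R) / Real.log q⌋₊ + 1 with hm
  set D : Fin m → ℝ := fun j => Δ / q ^ (j : ℕ) with hDdef
  have hD : ∀ j, R ≤ D j := fun j => by
    have h1 : ((j : ℕ) : ℝ) ≤ Real.log (Δ / R) / Real.log q := by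
      have hj : (j : ℕ) ≤ ⌊Real.log (Δ / R) / Real.log q⌋₊ := Nat.lt_succ_iff.1 j.2
      refine (Nat.cast_le.2 hj).trans (Nat.floor_le ?_)
      exact div_nonneg (Real.log_nonneg ((one_le_div hR0).2 hRΔ)) hlogq.le
    rw [le_div_iff₀ hlogq, ← Real.log_pow,
      Real.log_le_log_iff (by positivity) (by positivity), le_div_iff₀ hR0] at h1
    rw [hDdef, le_div_iff₀ (by positivity)]
    linarith
  have hgeom : ∀ j, P / D j ^ α = P / Δ ^ α * (2 * β + 1) ^ (j : ℕ) := fun j => by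
    rw [hDdef, Real.div_rpow hΔ0.le (by positivity), ← Real.rpow_pow_comm (by positivity), hqα,
      div_div_eq_mul_div, div_mul_eq_mul_div]
  have hB : 0 < P / Δ ^ α := by positivity
  have hNB : 2 * β * N ≤ P / Δ ^ α := by
    rw [le_div_iff₀ (by positivity)]
    linarith
  have hnum : (jammedTower R D).numSuccess α β N P (jam m) ≤ 2 := jammedTower_numSuccess_le
  refine ⟨m + 2, jammedTower R D, jam m, jammedTower_normalized hR.le hD,
    jammedTower_delta hR.le hD (fun j => div_le_self hΔ0.le (one_le_pow₀ hq.le))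
      (j₀ := ⟨0, Nat.succ_pos _⟩) (by simp [hDdef]),
    jammedTower_isPureNash hα hβ hN hP0 hR.le hD hRα hNP, ?_, ?_⟩
  · classical
    refine Finset.card_pos.2 ⟨0, Finset.mem_filter.2 ⟨Finset.mem_univ _, ?_⟩⟩
    exact jammedTower_success_jam hα hβ hN hP0 hR.le hD hRα hNP (by simp [jam])
  · have hopt : (m : ℝ) ≤ (jammedTower R D).opt α β N P := by
      exact_mod_cast le_jammedTower_opt hβ hP0 hR.le hD hB hNB hgeom
    have hnum' : ((jammedTower R D).numSuccess α β N P (jam m) : ℝ) ≤ 2 := by exact_mod_cast hnum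
    have hlogΔ : 0 ≤ Real.log Δ := Real.log_nonneg hΔ1
    -- as `R ^ 2 ≤ Δ`, the quotient `Δ / R` is at least the square root of `Δ`
    have hhalf : Real.log Δ / 2 ≤ Real.log (Δ / R) := by
      have := Real.log_le_log (by positivity) hΔ
      rw [Real.log_pow] at this
      rw [Real.log_div hΔ0.ne' hR0.ne']
      push_cast at this
      linarith
    have hmlow : Real.log (Δ / R) / Real.log q ≤ m := by
      rw [hm]
      push_cast
      exact (Nat.lt_floor_add_one _).le
    calc 1 / (4 * Real.log q) * Real.log Δ * ((jammedTower R D).numSuccess α β N P (jam m) : ℝ)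
        ≤ 1 / (4 * Real.log q) * Real.log Δ * 2 := by gcongr
      _ = Real.log Δ / 2 / Real.log q := by field_simp; ring
      _ ≤ Real.log (Δ / R) / Real.log q := by gcongr
      _ ≤ m := hmlow
      _ ≤ _ := hopt

end LinkSet
end SINR

theorem mainTheorem9 (α β : ℝ) (hα : 0 < α) (hβ : 1 < β) :
    -- upper bound
    (∀ κ : ℝ, κ < 1 / 2 → ∃ C : ℝ, 0 < C ∧
      ∀ (N P : ℝ), 0 ≤ N → 0 < P →
      ∀ (n : ℕ) (L : SINR.LinkSet n), L.Normalized →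
      ∀ ε : ℝ, 0 ≤ ε → (n : ℝ) * ε ≤ κ →
        L.priceOfTotalAnarchy α β N P ε ≤ ENNReal.ofReal (C * (1 + Real.log L.delta))) ∧
    -- tightness, through a bad pure Nash equilibrium
    (∃ c Δ₀ : ℝ, 0 < c ∧ 1 < Δ₀ ∧
      ∀ (N Δ : ℝ), 0 ≤ N → Δ₀ ≤ Δ →
      ∃ P₀ : ℝ, 0 < P₀ ∧ ∀ P : ℝ, P₀ ≤ P →
      ∃ (n : ℕ) (L : SINR.LinkSet n) (a : SINR.Profile n),
        L.Normalized ∧ L.delta = Δ ∧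
        L.IsPureNash α β N P a ∧ 0 < L.numSuccess α β N P a ∧
        c * Real.log Δ * (L.numSuccess α β N P a : ℝ) ≤ (L.opt α β N P : ℝ) ∧
        ∀ ε : ℝ, 0 ≤ ε →
          ENNReal.ofReal (c * Real.log Δ) ≤ L.priceOfTotalAnarchy α β N P ε) := by
  constructor
  · intro κ hκ
    refine ⟨_, SINR.LinkSet.upperConst_pos hα hβ hκ, fun N P hN hP n L hL ε hε hnε => ?_⟩
    exact SINR.LinkSet.priceOfTotalAnarchy_le hL hα hβ hN hP hκ hnε
  · obtain ⟨c, Δ₀, hc, hΔ₀, h⟩ := SINR.LinkSet.exists_bad_pureNash hα hβ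
    refine ⟨c, Δ₀, hc, hΔ₀, fun N Δ hN hΔ => ?_⟩
    obtain ⟨P₀, hP₀, h⟩ := h N Δ hN hΔ
    refine ⟨P₀, hP₀, fun P hP => ?_⟩
    obtain ⟨n, L, a, hL, hdelta, ha, hpos, hopt⟩ := h P hP
    exact ⟨n, L, a, hL, hdelta, ha, hpos, hopt, fun ε hε =>
      ha.le_priceOfTotalAnarchy hε hpos hopt⟩
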